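/- Let $n \ge 2$ be an integer and let $K, L \subset \mathbb{R}^n$ be convex bodies, that is, compact convex sets with non-empty interior. Define their Banach--Mazur distance by $$d(K,L) = \inf\{\, r > 0 : K + u \subset T(L+v) \subset r(K+u) \text{ for some invertible linear } T:\mathbb{R}^n \to \mathbb{R}^n \text{ and some } u, v \in \mathbb{R}^n \,\}.$$ Then $$d(K,L) < n^2 - 2^{-22}\, n^{-7}.$$ -/

import Mathlib

open scoped Pointwise

/-- The set of ratios `r > 0` for which there are an invertible linear operator `T` of `ℝⁿ` and
vectors `u, v` with `K + u ⊆ T (L + v) ⊆ r (K + u)`. -/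
def banachMazurRatios {n : ℕ} (K L : Set (EuclideanSpace ℝ (Fin n))) : Set ℝ :=
  {r : ℝ | 0 < r ∧
    ∃ (T : EuclideanSpace ℝ (Fin n) ≃ₗ[ℝ] EuclideanSpace ℝ (Fin n))
      (u v : EuclideanSpace ℝ (Fin n)),
      K + {u} ⊆ T '' (L + {v}) ∧ T '' (L + {v}) ⊆ r • (K + {u})}

/-- The Banach-Mazur distance of two (not necessarily symmetric) convex bodies in `ℝⁿ`. -/
noncomputable def banachMazurDist {n : ℕ} (K L : Set (EuclideanSpace ℝ (Fin n))) : ℝ :=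
  sInf (banachMazurRatios K L)

/-- A convex body with non-empty interior has a translate lying between two balls
centred at the origin. -/
theorem exists_translate_between_balls {n : ℕ} (K : ConvexBody (EuclideanSpace ℝ (Fin n)))
    (hK : (interior (K : Set (EuclideanSpace ℝ (Fin n)))).Nonempty) :
    ∃ (u : EuclideanSpace ℝ (Fin n)) (a b : ℝ), 0 < a ∧ 0 < b ∧
      Metric.ball 0 a ⊆ (K : Set (EuclideanSpace ℝ (Fin n))) + {u} ∧
      (K : Set (EuclideanSpace ℝ (Fin n))) + {u} ⊆ Metric.ball 0 b := by
  obtain ⟨c, hc⟩ := hK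
  obtain ⟨a, ha, hball⟩ := Metric.isOpen_iff.1 isOpen_interior c hc
  obtain ⟨b, hb⟩ := K.isCompact.isBounded.subset_ball c
  have hcK : c ∈ (K : Set (EuclideanSpace ℝ (Fin n))) := interior_subset hc
  have hb0 : 0 < b := by simpa using hb hcK
  refine ⟨-c, a, b, ha, hb0, ?_, ?_⟩
  · intro x hx
    refine Set.mem_add.2 ⟨x + c, interior_subset (hball ?_), -c, rfl, by simp⟩
    simpa [dist_eq_norm] using hx
  · intro x hx
    obtain ⟨y, hy, z, hz, rfl⟩ := Set.mem_add.1 hx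
    rw [Set.mem_singleton_iff.1 hz]
    have := hb hy
    simpa [dist_eq_norm, sub_eq_add_neg] using this

/-- The infimum defining the Banach-Mazur distance of convex bodies with non-empty interior is
taken over a non-empty set. -/
theorem banachMazurRatios_nonempty {n : ℕ} (K L : ConvexBody (EuclideanSpace ℝ (Fin n)))
    (hK : (interior (K : Set (EuclideanSpace ℝ (Fin n)))).Nonempty)
    (hL : (interior (L : Set (EuclideanSpace ℝ (Fin n)))).Nonempty) :
    (banachMazurRatios (K : Set (EuclideanSpace ℝ (Fin n)))
      (L : Set (EuclideanSpace ℝ (Fin n)))).Nonempty := by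
  obtain ⟨u, a, b, ha, hb, hK1, hK2⟩ := exists_translate_between_balls K hK
  obtain ⟨v, c, d, hc, hd, hL1, hL2⟩ := exists_translate_between_balls L hL
  have hs : 0 < b / c := by positivity
  have hr : 0 < b / c * d / a := by positivity
  refine ⟨b / c * d / a, hr, LinearEquiv.smulOfNeZero ℝ _ (b / c) hs.ne', u, v, ?_, ?_⟩
  · intro x hx
    have hxb : ‖x‖ < b := by simpa using hK2 hx
    refine ⟨(b / c)⁻¹ • x, hL1 ?_, by
      simp only [LinearEquiv.smulOfNeZero_apply]
      exact smul_inv_smul₀ hs.ne' x⟩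
    rw [mem_ball_zero_iff, norm_smul, Real.norm_of_nonneg (by positivity),
      inv_mul_lt_iff₀ hs, div_mul_cancel₀ _ hc.ne']
    exact hxb
  · rintro _ ⟨y, hy, rfl⟩
    have hyd : ‖y‖ < d := by simpa using hL2 hy
    rw [LinearEquiv.smulOfNeZero_apply, Set.mem_smul_set_iff_inv_smul_mem₀ hr.ne']
    apply hK1
    rw [mem_ball_zero_iff, norm_smul, norm_smul, Real.norm_of_nonneg (by positivity),
      Real.norm_of_nonneg hs.le, inv_mul_lt_iff₀ hr, div_mul_cancel₀ _ ha.ne']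
    exact mul_lt_mul_of_pos_left hyd hs

/-- The infimum defining the Banach-Mazur distance is taken over a set bounded below. -/
theorem banachMazurRatios_bddBelow {n : ℕ} (K L : Set (EuclideanSpace ℝ (Fin n))) :
    BddBelow (banachMazurRatios K L) :=
  ⟨0, fun _ hr => hr.1.le⟩

/-!
The bound comes from `d(K, L) ≤ n s`, where `s` is the Minkowski asymmetry of `K` or of `L`, and
from the rigidity of the bodies whose asymmetry is close to its maximal value `n`.

*Grünbaum distance.* Let `0` be interior to `L` and let `K' = T K + a` have maximal volume among the
affine images of `K` inside `L`. The first-order optimality condition is a John decomposition: there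
are points `xᵢ ∈ K'`, vectors `yᵢ` in the polar of `L` with `⟪xᵢ, yᵢ⟫ = 1`, and weights `λᵢ ≥ 0` of
sum `1`, with `∑ λᵢ xᵢ ⊗ yᵢ = n⁻¹ • 1` and `∑ λᵢ yᵢ = 0` (`traceFunctional_mem_convexHull_contact`).
For `x ∈ L` the convex combination `∑ λᵢ (1 - ⟪x, yᵢ⟫) xᵢ` of points of `K'` equals
`∑ λᵢ xᵢ - n⁻¹ x`, so `L` lies in a translate of `-n K'`
(`exists_affine_image_subset_and_subset_neg_smul`). If moreover `-K` lies in a translate of `s K`,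
then `K' ⊆ L` and `L` lies in a translate of `n s K'`. The same holds with the roles of
`K` and `L` exchanged.

*Stability.* Fix `s = n - ε`. By Helly's theorem, if `-K` lies in no translate of `s K`, then some
`n + 1` points of `K` already obstruct this. These points must be affinely independent, and `K` must
lie in a slight enlargement of the simplex they span, since otherwise `K` contains a point a little
beyond a facet centroid, which leaves enough room to remove the obstruction
(`exists_center_or_exists_simplex`).

With `ε = (3 n + 2)⁻¹`, either one of the bodies has asymmetry at most `n - ε`, and
`d(K, L) ≤ n (n - ε) ≤ n ^ 2 - 1 / 4`, or both lie between a simplex and its enlargement of ratio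
`3 / 2`, and `d(K, L) ≤ 9 / 4`. Both values are below the claimed bound.
-/

open scoped Pointwise

/-! ### Compactness and first-order variation -/

section

open Filter Topology Module

/-- In finite dimension the convex hull of a compact set is compact: by Carathéodory's theorem it
is a finite union of continuous images of products of a standard simplex with powers of the set. -/
theorem IsCompact.convexHull_of_finiteDimensional {V : Type*} [AddCommGroup V] [Module ℝ V]
    [TopologicalSpace V] [IsTopologicalAddGroup V] [ContinuousSMul ℝ V] [FiniteDimensional ℝ V]
    {s : Set V} (hs : IsCompact s) :
    IsCompact (convexHull ℝ s) := by
  have key : convexHull ℝ s = ⋃ k ∈ Finset.range (finrank ℝ V + 2),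
      (fun p : (Fin k → ℝ) × (Fin k → V) => ∑ i, p.1 i • p.2 i) ''
        (stdSimplex ℝ (Fin k) ×ˢ Set.univ.pi fun _ => s) := by
    apply Set.Subset.antisymm
    · intro x hx
      obtain ⟨ι, _, z, w, hz, hind, hw, hw1, rfl⟩ := eq_pos_convex_span_of_mem_convexHull hx
      have hcard : Fintype.card ι ≤ finrank ℝ V + 1 :=
        hind.card_le_finrank_succ.trans (Nat.succ_le_succ (Submodule.finrank_le _))
      let e := (Fintype.equivFin ι).symm
      refine Set.mem_biUnion (x := Fintype.card ι)
        (Finset.mem_coe.2 (Finset.mem_range.2 (by omega)))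
        ⟨(w ∘ e, z ∘ e), ⟨⟨fun i => (hw _).le, ?_⟩, fun i _ => hz ⟨e i, rfl⟩⟩, ?_⟩
      · rw [← hw1]; exact e.sum_comp w
      · exact e.sum_comp fun i => w i • z i
    · refine Set.iUnion₂_subset fun k _ => ?_
      rintro _ ⟨⟨w, z⟩, ⟨hw, hz⟩, rfl⟩
      exact mem_convexHull_of_exists_fintype w z hw.1 hw.2 (fun i => hz i trivial) rfl
  rw [key]
  exact (Finset.range _).isCompact_biUnion fun k _ =>
    ((isCompact_stdSimplex ℝ (Fin k)).prod (isCompact_univ_pi fun _ => hs)).image (by fun_prop)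

variable {E : Type*} [NormedAddCommGroup E] [InnerProductSpace ℝ E]

/-- The linear functional `(A, b) ↦ ⟪A x + b, y⟫` on pairs of an operator and a vector. -/
noncomputable def contactFunctional (x y : E) : StrongDual ℝ ((E →L[ℝ] E) × E) :=
  (innerSL ℝ y).comp ((ContinuousLinearMap.apply ℝ E x).comp
    (ContinuousLinearMap.fst ℝ (E →L[ℝ] E) E) + ContinuousLinearMap.snd ℝ (E →L[ℝ] E) E)

theorem contactFunctional_apply (x y : E) (g : (E →L[ℝ] E) × E) :
    contactFunctional x y g = inner ℝ (g.1 x + g.2) y := by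
  rw [real_inner_comm]; rfl

variable [FiniteDimensional ℝ E]

/-- The trace is the derivative of the determinant at the identity, so moving the identity a little
in a direction of positive trace increases the determinant. -/
theorem eventually_one_lt_det_one_add_smul {A : E →L[ℝ] E}
    (hA : 0 < LinearMap.trace ℝ E A) :
    ∀ᶠ t : ℝ in 𝓝[>] 0, 1 < (1 + t • A : E →L[ℝ] E).det := by
  let b := finBasis ℝ E
  let M := LinearMap.toMatrix b b (A : E →ₗ[ℝ] E)
  let q := (1 + (Polynomial.X : Polynomial ℝ) • M.map Polynomial.C).det.divX.divX
  have hdet (t : ℝ) : (1 + t • A : E →L[ℝ] E).det = 1 + t * (M.trace + q.eval t * t) := by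
    have h : (1 + t • A : E →L[ℝ] E).det = (1 + t • M).det := by
      rw [ContinuousLinearMap.det, ← LinearMap.det_toMatrix b]
      congr 1
      have : ((1 + t • A : E →L[ℝ] E) : E →ₗ[ℝ] E) = LinearMap.id + t • (A : E →ₗ[ℝ] E) := rfl
      rw [this, map_add, map_smul, LinearMap.toMatrix_id]
    rw [h, Matrix.det_one_add_smul]
    ring
  have hM : 0 < M.trace := by rwa [← LinearMap.trace_eq_matrix_trace ℝ b]
  have hcont : Continuous fun t : ℝ => M.trace + q.eval t * t := by fun_prop
  have hev : ∀ᶠ t : ℝ in 𝓝 0, 0 < M.trace + q.eval t * t :=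
    hcont.continuousAt.eventually_const_lt (by simpa using hM)
  filter_upwards [nhdsWithin_le_nhds hev, self_mem_nhdsWithin] with t ht ht0
  rw [hdet]
  have := mul_pos (Set.mem_Ioi.1 ht0) ht
  linarith

/-- A compactness argument: if `F ≤ 1` on a compact set and `G < 0` wherever `F = 1` there, then
`F + t G ≤ 1` on that set for all small `t ≥ 0`. -/
theorem IsCompact.eventually_add_mul_le_one {X : Type*} [TopologicalSpace X] {P : Set X}
    (hP : IsCompact P) {F G : X → ℝ} (hF : Continuous F) (hG : Continuous G)
    (hF1 : ∀ p ∈ P, F p ≤ 1) (hneg : ∀ p ∈ P, F p = 1 → G p < 0) :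
    ∀ᶠ t : ℝ in 𝓝 0, ∀ p ∈ P, 0 ≤ t → F p + t * G p ≤ 1 := by
  have : ∀ᶠ t : ℝ in 𝓝 0, ∀ p ∈ P, p ∈ P → 0 ≤ t → F p + t * G p ≤ 1 := by
    refine hP.eventually_forall_of_forall_eventually fun p hp => ?_
    rcases (hF1 p hp).lt_or_eq with h | h
    · have hc : Continuous fun z : ℝ × X => F z.2 + z.1 * G z.2 := by fun_prop
      have : ∀ᶠ z in 𝓝 ((0 : ℝ), p), F z.2 + z.1 * G z.2 < 1 :=
        hc.continuousAt.eventually_lt_const (by simpa using h)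
      filter_upwards [this] with z hz _ _ using hz.le
    · have hc : Continuous fun z : ℝ × X => G z.2 := by fun_prop
      have : ∀ᶠ z in 𝓝 ((0 : ℝ), p), G z.2 < 0 :=
        hc.continuousAt.eventually_lt_const (hneg p hp h)
      filter_upwards [this] with z hz hzP ht
      nlinarith [hF1 _ hzP, mul_nonneg ht (neg_nonneg.2 hz.le)]
  filter_upwards [this] with t ht p hp using ht p hp hp

/-! ### Polar sets and the John decomposition -/

/-- The polar of `L` with respect to the point `c`. -/
def polarAt (c : E) (L : Set E) : Set E := {y | ∀ x ∈ L, inner ℝ (x - c) y ≤ 1}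

theorem isCompact_polarAt {c : E} {a : ℝ} {L : Set E} (ha : 0 < a)
    (hL : Metric.ball c a ⊆ L) : IsCompact (polarAt c L) := by
  refine Metric.isCompact_of_isClosed_isBounded ?_ ?_
  · have : polarAt c L = ⋂ x ∈ L, {y | inner ℝ (x - c) y ≤ 1} := by
      ext; simp [polarAt]
    rw [this]
    exact isClosed_biInter fun x _ => isClosed_le (by fun_prop) continuous_const
  · refine (Metric.isBounded_closedBall (x := (0 : E)) (r := 2 / a)).subset fun y hy => ?_
    rw [mem_closedBall_zero_iff]
    rcases eq_or_ne y 0 with rfl | hy0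
    · simp only [norm_zero]; positivity
    have hn : 0 < ‖y‖ := norm_pos_iff.2 hy0
    have := hy (c + (a / 2 / ‖y‖) • y) (hL (by
      rw [Metric.mem_ball, dist_eq_norm, add_sub_cancel_left, norm_smul,
        Real.norm_of_nonneg (by positivity), div_mul_cancel₀ _ hn.ne']
      linarith))
    rw [add_sub_cancel_left, real_inner_smul_left, real_inner_self_eq_norm_sq] at this
    have h2 : a / 2 / ‖y‖ * ‖y‖ ^ 2 = a / 2 * ‖y‖ := by field_simp
    rw [h2] at this
    rw [le_div_iff₀ ha]
    linarith

/-- The bipolar theorem. -/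
theorem mem_of_forall_mem_polarAt {c x : E} {L : Set E} (hconv : Convex ℝ L) (hcl : IsClosed L)
    (hc : c ∈ L) (hx : ∀ y ∈ polarAt c L, inner ℝ (x - c) y ≤ 1) : x ∈ L := by
  by_contra hxL
  obtain ⟨f, u, hf, hu⟩ := geometric_hahn_banach_closed_point hconv hcl hxL
  let y := (InnerProductSpace.toDual ℝ E).symm f
  have hy (v : E) : inner ℝ v y = f v := by
    rw [real_inner_comm]; exact InnerProductSpace.toDual_symm_apply
  have hpos : 0 < u - f c := sub_pos.2 (hf c hc)
  have := hx ((u - f c)⁻¹ • y) fun v hv => by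
    rw [real_inner_smul_right, hy, inv_mul_le_iff₀ hpos, map_sub]
    linarith [hf v hv]
  rw [real_inner_smul_right, hy, inv_mul_le_iff₀ hpos, map_sub] at this
  linarith

/-- The linear functional `(A, b) ↦ tr A` on pairs of an operator and a vector. -/
noncomputable def traceFunctional (E : Type*) [NormedAddCommGroup E] [InnerProductSpace ℝ E]
    [FiniteDimensional ℝ E] : StrongDual ℝ ((E →L[ℝ] E) × E) :=
  LinearMap.toContinuousLinearMap
    ((LinearMap.trace ℝ E).comp ((ContinuousLinearMap.coeLM ℝ).comp (LinearMap.fst ℝ _ _)))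

theorem traceFunctional_apply (g : (E →L[ℝ] E) × E) :
    traceFunctional E g = LinearMap.trace ℝ E g.1 := rfl

/-- John's decomposition of the identity for a pair of bodies: if no affine image of `K` inside `L`
has larger volume than `K`, then convex combinations of the contact pairs give the normalized
trace. Otherwise a separating `(A, b)` yields a perturbation of the identity that keeps `K` inside
`L` and increases the volume. -/
theorem traceFunctional_mem_convexHull_contact [Nontrivial E] {K L : Set E} {c : E} {a : ℝ}
    (hK : IsCompact K) (hLconv : Convex ℝ L) (hLcl : IsClosed L) (ha : 0 < a)
    (hcL : Metric.ball c a ⊆ L) (hKL : K ⊆ L)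
    (hmax : ∀ (A : E →L[ℝ] E) (b : E), (∀ x ∈ K, A x + b ∈ L) → A.det ≤ 1) :
    (finrank ℝ E : ℝ)⁻¹ • traceFunctional E ∈ convexHull ℝ
      ((fun p : E × E => contactFunctional (p.1 - c) p.2) ''
        {p | p ∈ K ×ˢ polarAt c L ∧ inner ℝ (p.1 - c) p.2 = 1}) := by
  have hn : (0 : ℝ) < finrank ℝ E := Nat.cast_pos.2 finrank_pos
  have hP := hK.prod (isCompact_polarAt ha hcL)
  have hcompact : IsCompact {p : E × E | p ∈ K ×ˢ polarAt c L ∧ inner ℝ (p.1 - c) p.2 = 1} :=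
    hP.inter_right (isClosed_eq (f := fun p : E × E => inner ℝ (p.1 - c) p.2) (by fun_prop)
      continuous_const)
  have hhull := (hcompact.image (f := fun p : E × E => contactFunctional (p.1 - c) p.2)
    (by unfold contactFunctional; fun_prop)).convexHull_of_finiteDimensional
  by_contra hτ
  obtain ⟨f, u, hf, hu⟩ := geometric_hahn_banach_closed_point (convex_convexHull ℝ _)
    hhull.isClosed hτ
  -- by reflexivity the separating functional is evaluation at a pair `(A, b)`
  let g : (E →L[ℝ] E) × E := (evalEquiv ℝ ((E →L[ℝ] E) × E)).symm
    (f.toLinearMap ∘ₗ (LinearMap.toContinuousLinearMap (𝕜 := ℝ)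
      (E := (E →L[ℝ] E) × E) (F' := ℝ)).toLinearMap)
  have hg (φ : StrongDual ℝ ((E →L[ℝ] E) × E)) : f φ = φ g := by
    have := apply_evalEquiv_symm_apply ℝ ((E →L[ℝ] E) × E) φ.toLinearMap
      (f.toLinearMap ∘ₗ (LinearMap.toContinuousLinearMap (𝕜 := ℝ)
      (E := (E →L[ℝ] E) × E) (F' := ℝ)).toLinearMap)
    exact this.symm
  -- subtracting `u • 1` makes the pairing with contact pairs negative and keeps the trace positive
  let A : E →L[ℝ] E := g.1 - u • 1
  have htr : 0 < LinearMap.trace ℝ E A := by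
    have h1 : LinearMap.trace ℝ E A = LinearMap.trace ℝ E g.1 - u * finrank ℝ E := by
      have : (A : E →ₗ[ℝ] E) = (g.1 : E →ₗ[ℝ] E) - u • LinearMap.id := rfl
      rw [this, map_sub, map_smul, LinearMap.trace_id, smul_eq_mul]
    rw [hg, smul_apply, traceFunctional_apply, smul_eq_mul,
      lt_inv_mul_iff₀ hn] at hu
    rw [h1]; linarith
  have hneg : ∀ p ∈ K ×ˢ polarAt c L, inner ℝ (p.1 - c) p.2 = 1 →
      inner ℝ (A (p.1 - c) + g.2) p.2 < 0 := fun p hp hp1 => by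
    have := hf _ (subset_convexHull ℝ _ ⟨p, ⟨hp, hp1⟩, rfl⟩)
    rw [hg, contactFunctional_apply] at this
    have h2 : A (p.1 - c) + g.2 = (g.1 (p.1 - c) + g.2) - u • (p.1 - c) := by
      simp only [A, sub_apply, smul_apply,
        one_apply_eq_self]
      abel
    rw [h2, inner_sub_left, real_inner_smul_left, hp1]
    linarith
  have hev := hP.eventually_add_mul_le_one (F := fun p => inner ℝ (p.1 - c) p.2)
    (G := fun p => inner ℝ (A (p.1 - c) + g.2) p.2) (by fun_prop) (by fun_prop)
    (fun p hp => hp.2 _ (hKL hp.1)) hneg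
  obtain ⟨t, ⟨ht, hdet⟩, ht0⟩ := (((hev.filter_mono nhdsWithin_le_nhds).and
    (eventually_one_lt_det_one_add_smul htr)).and self_mem_nhdsWithin).exists
  refine (hmax (1 + t • A) (t • (g.2 - A c)) fun x hx => ?_).not_gt hdet
  refine mem_of_forall_mem_polarAt hLconv hLcl (hcL (Metric.mem_ball_self ha)) fun y hy => ?_
  have h := ht (x, y) ⟨hx, hy⟩ (le_of_lt ht0)
  have h3 : (1 + t • A) x + t • (g.2 - A c) - c = (x - c) + t • (A (x - c) + g.2) := by
    simp only [add_apply, one_apply_eq_self,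
      smul_apply, map_sub, smul_sub, smul_add]
    abel
  rw [h3, inner_add_left, real_inner_smul_left]
  exact h

/-- If no affine image of `K` inside `L` has larger volume than `K`, then `L` lies in a translate
of `-n K`. -/
theorem exists_sub_inv_smul_mem_of_maximal [Nontrivial E] {K L : Set E} {c : E} {a : ℝ}
    (hK : IsCompact K) (hKconv : Convex ℝ K) (hLconv : Convex ℝ L) (hLcl : IsClosed L)
    (ha : 0 < a) (hcL : Metric.ball c a ⊆ L) (hKL : K ⊆ L)
    (hmax : ∀ (A : E →L[ℝ] E) (b : E), (∀ x ∈ K, A x + b ∈ L) → A.det ≤ 1) :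
    ∃ z : E, ∀ x ∈ L, z - (finrank ℝ E : ℝ)⁻¹ • x ∈ K := by
  have hmem := traceFunctional_mem_convexHull_contact hK hLconv hLcl ha hcL hKL hmax
  rw [mem_convexHull_iff_exists_fintype] at hmem
  obtain ⟨ι, _, w, φ, hw, hw1, hφ, hsum⟩ := hmem
  choose p hp hpφ using hφ
  have hid (g : (E →L[ℝ] E) × E) : (finrank ℝ E : ℝ)⁻¹ * LinearMap.trace ℝ E g.1 =
      ∑ i, w i * inner ℝ (g.1 ((p i).1 - c) + g.2) (p i).2 := by
    have := congrArg (fun f : StrongDual ℝ ((E →L[ℝ] E) × E) => f g) hsum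
    simp only [sum_apply, smul_apply, ← hpφ,
      contactFunctional_apply, traceFunctional_apply, smul_eq_mul] at this
    exact this.symm
  have hzero (b : E) : ∑ i, w i * inner ℝ b (p i).2 = 0 := by
    have := hid (0, b)
    simpa using this.symm
  have hrank (x : E) : ∑ i, (w i * inner ℝ x (p i).2) • ((p i).1 - c) =
      (finrank ℝ E : ℝ)⁻¹ • x := by
    refine ext_inner_right ℝ fun v => ?_
    have := hid (InnerProductSpace.rankOne ℝ x v, 0)
    rw [InnerProductSpace.trace_rankOne] at this
    simp only [InnerProductSpace.rankOne_apply, add_zero, real_inner_smul_left] at this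
    rw [real_inner_smul_left, real_inner_comm v x, this, sum_inner]
    refine Finset.sum_congr rfl fun i _ => ?_
    rw [real_inner_smul_left, real_inner_comm v]
    ring
  refine ⟨∑ i, w i • (p i).1 + (finrank ℝ E : ℝ)⁻¹ • c, fun x hx => ?_⟩
  have hmem : ∑ i, (w i * (1 - inner ℝ (x - c) (p i).2)) • (p i).1 ∈ K := by
    refine hKconv.sum_mem (fun i _ => mul_nonneg (hw i) (sub_nonneg.2 ((hp i).1.2 x hx))) ?_
      fun i _ => (hp i).1.1
    simp only [mul_sub, mul_one, Finset.sum_sub_distrib, hw1, hzero, sub_zero]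
  convert hmem using 1
  have h1 := hrank (x - c)
  have h2 : ∑ i, (w i * inner ℝ (x - c) (p i).2) • c = 0 := by
    rw [← Finset.sum_smul, hzero, zero_smul]
  simp only [smul_sub, Finset.sum_sub_distrib, h2, sub_zero] at h1
  simp only [mul_sub, mul_one, sub_smul, Finset.sum_sub_distrib, h1]
  abel

/-! ### Maximal affine images and the Grünbaum distance -/

/-- Among the affine images of `K` contained in `L` there is one of maximal volume, and it is not
degenerate. -/
theorem exists_affine_image_maximal_det {K L : Set E} (hL : IsCompact L)
    (hKb : Bornology.IsBounded K) (hKint : (interior K).Nonempty) (hLint : (interior L).Nonempty) :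
    ∃ (T : E →L[ℝ] E) (a : E), (∀ x ∈ K, T x + a ∈ L) ∧ 0 < T.det ∧
      ∀ (S : E →L[ℝ] E) (b : E), (∀ x ∈ K, S x + b ∈ L) → S.det ≤ T.det := by
  obtain ⟨x₀, hx₀⟩ := hKint
  obtain ⟨y₀, hy₀⟩ := hLint
  obtain ⟨r, hr, hrK⟩ := Metric.isOpen_iff.1 isOpen_interior x₀ hx₀
  obtain ⟨ρ, hρ, hρL⟩ := Metric.isOpen_iff.1 isOpen_interior y₀ hy₀
  obtain ⟨R, hR, hRL⟩ := hL.isBounded.exists_pos_norm_le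
  obtain ⟨Q, hQ, hQK⟩ := hKb.exists_pos_norm_le
  let D : Set ((E →L[ℝ] E) × E) := {g | ∀ x ∈ K, g.1 x + g.2 ∈ L}
  have hDclosed : IsClosed D := by
    have : D = ⋂ x ∈ K, (fun g : (E →L[ℝ] E) × E => g.1 x + g.2) ⁻¹' L := by ext; simp [D]
    rw [this]
    exact isClosed_biInter fun x _ => hL.isClosed.preimage (by fun_prop)
  have hx₀K : x₀ ∈ K := interior_subset hx₀
  have hDbdd : Bornology.IsBounded D := by
    refine (Metric.isBounded_closedBall (x := (0 : (E →L[ℝ] E) × E))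
      (r := max (4 * R / r) (R + 4 * R / r * ‖x₀‖))).subset fun g hg => ?_
    -- `g.1` maps the `r`-ball into `L - L`, whose elements have norm at most `2 * R`
    have h1 : ‖g.1‖ ≤ 4 * R / r := by
      refine ContinuousLinearMap.opNorm_le_of_shell hr (by positivity) (c := (2 : ℝ)) (by simp)
        fun v hv1 hv2 => ?_
      have hv : x₀ + v ∈ K := interior_subset (hrK (by simpa using hv2))
      have e : g.1 v = (g.1 (x₀ + v) + g.2) - (g.1 x₀ + g.2) := by rw [map_add]; abel
      have h2 : ‖g.1 v‖ ≤ 2 * R := by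
        rw [e]
        linarith [norm_sub_le (g.1 (x₀ + v) + g.2) (g.1 x₀ + g.2), hRL _ (hg _ hv),
          hRL _ (hg _ hx₀K)]
      rw [Real.norm_eq_abs, abs_two] at hv1
      calc ‖g.1 v‖ ≤ 2 * R := h2
        _ = 4 * R / r * (r / 2) := by field_simp; ring
        _ ≤ 4 * R / r * ‖v‖ := by gcongr
    have h2 : ‖g.2‖ ≤ R + 4 * R / r * ‖x₀‖ := by
      have e : g.2 = (g.1 x₀ + g.2) - g.1 x₀ := by abel
      calc ‖g.2‖ ≤ ‖g.1 x₀ + g.2‖ + ‖g.1 x₀‖ := by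
            conv_lhs => rw [e]
            exact norm_sub_le _ _
        _ ≤ R + 4 * R / r * ‖x₀‖ := add_le_add (hRL _ (hg _ hx₀K))
            (g.1.le_of_opNorm_le h1 x₀)
    rw [mem_closedBall_zero_iff, Prod.norm_def]
    exact max_le_max h1 h2
  have hDcompact : IsCompact D := Metric.isCompact_of_isClosed_isBounded hDclosed hDbdd
  -- a small homothetic copy of `K` inside `L` shows that the maximum is positive
  have hmem : ((ρ / (2 * Q)) • (1 : E →L[ℝ] E), y₀) ∈ D := fun x hx => by
    refine interior_subset (hρL ?_)
    rw [Metric.mem_ball, dist_eq_norm]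
    simp only [smul_apply, one_apply_eq_self,
      add_sub_cancel_right, norm_smul]
    rw [Real.norm_of_nonneg (by positivity)]
    calc ρ / (2 * Q) * ‖x‖ ≤ ρ / (2 * Q) * Q := by gcongr; exact hQK x hx
      _ = ρ / 2 := by field_simp
      _ < ρ := by linarith
  obtain ⟨g, hgD, hgmax⟩ := hDcompact.exists_isMaxOn ⟨_, hmem⟩
    (ContinuousLinearMap.continuous_det.comp continuous_fst).continuousOn
  refine ⟨g.1, g.2, hgD, lt_of_lt_of_le ?_ (hgmax hmem), fun S b hS => hgmax (a := (S, b)) hS⟩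
  have : ((ρ / (2 * Q)) • (1 : E →L[ℝ] E)).det = (ρ / (2 * Q)) ^ finrank ℝ E := by
    have h : (((ρ / (2 * Q)) • (1 : E →L[ℝ] E) : E →L[ℝ] E) : E →ₗ[ℝ] E) =
      (ρ / (2 * Q)) • LinearMap.id := rfl
    rw [ContinuousLinearMap.det, h, LinearMap.det_smul, LinearMap.det_id, mul_one]
  simp only [Function.comp, this]
  positivity

/-- Any two convex bodies have Grünbaum distance at most the dimension: some affine image of `K`
lies in `L` and the negative of its `n`-fold dilate contains `L` after a translation. -/
theorem exists_affine_image_subset_and_subset_neg_smul [Nontrivial E] {K L : Set E}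
    (hK : IsCompact K) (hKconv : Convex ℝ K) (hKint : (interior K).Nonempty)
    (hL : IsCompact L) (hLconv : Convex ℝ L) (hLint : (interior L).Nonempty) :
    ∃ (T : E ≃ₗ[ℝ] E) (a w : E), (∀ x ∈ K, T x + a ∈ L) ∧
      ∀ y ∈ L, ∃ x ∈ K, y = w - (finrank ℝ E : ℝ) • T x := by
  obtain ⟨T, a, hT, hdet, hmax⟩ := exists_affine_image_maximal_det hL hK.isBounded hKint hLint
  obtain ⟨y₀, hy₀⟩ := hLint
  obtain ⟨ρ, hρ, hρL⟩ := Metric.isOpen_iff.1 isOpen_interior y₀ hy₀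
  let K' := (fun x => T x + a) '' K
  have hK' : IsCompact K' := hK.image (by fun_prop)
  have hK'conv : Convex ℝ K' := by
    have : K' = (fun x => x + a) '' (T.toLinearMap '' K) := by
      rw [Set.image_image]; rfl
    rw [this]
    simpa [add_comm] using (hKconv.linear_image T.toLinearMap).translate a
  obtain ⟨z, hz⟩ := exists_sub_inv_smul_mem_of_maximal hK' hK'conv hLconv hL.isClosed hρ
    (hρL.trans interior_subset) (by rintro _ ⟨x, hx, rfl⟩; exact hT x hx) fun A b hA => by
      have h := hmax (A.comp T) (A a + b) fun x hx => by
        have := hA _ ⟨x, hx, rfl⟩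
        rwa [map_add, add_assoc] at this
      have hmul : (A.comp T).det = A.det * T.det := LinearMap.det_comp _ _
      rw [hmul] at h
      exact le_of_mul_le_mul_right (by rwa [one_mul]) hdet
  have hn : (finrank ℝ E : ℝ) ≠ 0 := Nat.cast_ne_zero.2 finrank_pos.ne'
  refine ⟨(T.toContinuousLinearEquivOfDetNeZero hdet.ne').toLinearEquiv, a,
    (finrank ℝ E : ℝ) • (z - a), hT, fun y hy => ?_⟩
  obtain ⟨x, hx, hxy⟩ := hz y hy
  refine ⟨x, hx, ?_⟩
  have hxy' : T x = z - (finrank ℝ E : ℝ)⁻¹ • y - a := eq_sub_of_add_eq hxy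
  have : (T.toContinuousLinearEquivOfDetNeZero hdet.ne').toLinearEquiv x = T x := rfl
  rw [this, hxy', smul_sub, smul_sub, smul_sub, smul_inv_smul₀ hn]
  abel

end

/-! ### Stability of the Minkowski asymmetry -/

section

open Filter Topology Module

variable {E : Type*} [AddCommGroup E] [Module ℝ E] {ι : Type*} [Fintype ι]

/-- For `ε = 0` the point in `hq` is the centroid of the facet opposite to `p k`. Once this slight
extension of the facet centroid beyond the facet lies in `K`, moving the centroid of the simplex
towards that facet gives a point `c` through which all vertices reflect into `K` with
ratio `s⁻¹`. -/
theorem exists_center_of_reflection_mem {K : Set E} (hK : Convex ℝ K) {s ε : ℝ} (hs : 0 < s)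
    (hε1 : ε ≤ 1) (hcard : (Fintype.card ι : ℝ) = s + ε + 1) {p : ι → E}
    (hp : ∀ i, p i ∈ K) (k : ι) (hq : s⁻¹ • (∑ i, p i - (ε + 1) • p k) ∈ K) :
    ∃ c : E, ∀ i, s⁻¹ • ((s + 1) • c - p i) ∈ K := by
  classical
  refine ⟨(s + 1)⁻¹ • (∑ i, p i - ε • p k), fun i => ?_⟩
  rw [smul_inv_smul₀ (by positivity)]
  rcases eq_or_ne i k with rfl | hik
  · convert hq using 2
    module
  have hmem : ∑ j, (s⁻¹ * (1 - (if j = k then ε else 0) - if j = i then 1 else 0)) • p j ∈ K := by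
    refine hK.sum_mem (fun j _ => mul_nonneg (inv_nonneg.2 hs.le) ?_) ?_ fun j _ => hp j
    · split_ifs with h1 h2 h2
      · exact absurd (h2.symm.trans h1) hik
      · linarith
      · linarith
      · linarith
    · rw [← Finset.mul_sum]
      simp only [Finset.sum_sub_distrib, Finset.sum_ite_eq', Finset.mem_univ, if_true,
        Finset.sum_const, Finset.card_univ, nsmul_eq_mul, mul_one, hcard]
      field_simp
      ring
  convert hmem using 1
  simp only [mul_smul, ← Finset.smul_sum, sub_smul, one_smul, Finset.sum_sub_distrib, ite_smul,
    zero_smul, Finset.sum_ite_eq', Finset.mem_univ, if_true]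

/-- For affinely dependent points the extended facet centroid is a convex combination of the points,
when the index with the largest coefficient in an affine dependence is omitted. -/
theorem exists_reflection_mem_of_not_affineIndependent {K : Set E} (hK : Convex ℝ K) {s ε : ℝ}
    (hs : 0 < s) (hε0 : 0 ≤ ε) (hε1 : ε ≤ 1) (hcard : (Fintype.card ι : ℝ) = s + ε + 1)
    {p : ι → E} (hp : ∀ i, p i ∈ K) (hdep : ¬ AffineIndependent ℝ p) :
    ∃ k, s⁻¹ • (∑ i, p i - (ε + 1) • p k) ∈ K := by
  classical
  rw [affineIndependent_iff] at hdep
  push Not at hdep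
  obtain ⟨t, w, hw0, hwp, i₀, hi₀, hwi₀⟩ := hdep
  let μ : ι → ℝ := fun j => if j ∈ t then w j else 0
  have hμ0 : ∑ j, μ j = 0 := by simpa [μ] using hw0
  have hμp : ∑ j, μ j • p j = 0 := by simpa [μ, ite_smul] using hwp
  obtain ⟨k, -, hk⟩ := Finset.exists_max_image Finset.univ (fun j => |μ j|) ⟨i₀, Finset.mem_univ _⟩
  have hμk : 0 < |μ k| := by
    refine lt_of_lt_of_le (abs_pos.2 ?_) (hk i₀ (Finset.mem_univ _))
    simpa [μ, hi₀] using hwi₀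
  have hμk0 : μ k ≠ 0 := abs_pos.1 hμk
  refine ⟨k, ?_⟩
  have hmem : ∑ j, (s⁻¹ * (1 - (if j = k then ε + 1 else 0) + ε * (μ k)⁻¹ * μ j)) • p j ∈ K := by
    refine hK.sum_mem (fun j _ => mul_nonneg (inv_nonneg.2 hs.le) ?_) ?_ fun j _ => hp j
    · split_ifs with h
      · rw [h, inv_mul_cancel_right₀ hμk0]; linarith
      · have h1 : |(μ k)⁻¹ * μ j| ≤ 1 := by
          rw [abs_mul, abs_inv, inv_mul_le_iff₀ hμk, mul_one]
          exact hk j (Finset.mem_univ _)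
        rw [mul_assoc]
        nlinarith [(abs_le.1 h1).1]
    · rw [← Finset.mul_sum]
      simp only [Finset.sum_add_distrib, Finset.sum_sub_distrib, Finset.sum_ite_eq',
        Finset.mem_univ, if_true, Finset.sum_const, Finset.card_univ, nsmul_eq_mul, mul_one, hcard,
        ← Finset.mul_sum, hμ0]
      field_simp
      ring
  convert hmem using 1
  simp only [mul_smul, ← Finset.smul_sum, sub_smul, add_smul, one_smul, Finset.sum_sub_distrib,
    Finset.sum_add_distrib, ite_smul, zero_smul, Finset.sum_ite_eq', Finset.mem_univ, if_true, hμp,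
    smul_zero, add_zero]

/-- If a point of `K` is far beyond some facet of the simplex `b`, then the extended centroid of the
facet with the most negative coordinate is a convex combination of that point and the vertices. -/
theorem exists_reflection_mem_of_coord_lt {K : Set E} (hK : Convex ℝ K) {s ε δ : ℝ}
    (hs : 0 < s) (hε0 : 0 ≤ ε) (hcard : (Fintype.card ι : ℝ) = s + ε + 1)
    (hδ : 0 < δ) (hεδ : ε * (δ⁻¹ + (s + ε)) ≤ 1) (b : AffineBasis ι ℝ E) (hb : ∀ i, b i ∈ K)
    {y : E} (hy : y ∈ K) {i : ι} (hi : b.coord i y < -δ) :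
    ∃ k, s⁻¹ • (∑ i, b i - (ε + 1) • b k) ∈ K := by
  classical
  obtain ⟨k, -, hk⟩ := Finset.exists_min_image Finset.univ (fun j => b.coord j y)
    ⟨i, Finset.mem_univ _⟩
  obtain ⟨m, hm⟩ : ∃ m, m = -b.coord k y := ⟨_, rfl⟩
  have hmδ : δ < m := by linarith [hk i (Finset.mem_univ _)]
  have hm0 : 0 < m := hδ.trans hmδ
  have hsum := b.sum_coord_apply_eq_one y
  have hupper (j : ι) : b.coord j y ≤ 1 + (s + ε) * m := by
    have h1 : ∑ l ∈ Finset.univ.erase j, -m ≤ ∑ l ∈ Finset.univ.erase j, b.coord l y :=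
      Finset.sum_le_sum fun l _ => by linarith [hk l (Finset.mem_univ _)]
    rw [← Finset.add_sum_erase _ _ (Finset.mem_univ j)] at hsum
    have hc : (((Finset.univ.erase j).card : ℕ) : ℝ) = s + ε := by
      rw [Finset.card_erase_of_mem (Finset.mem_univ j), Finset.card_univ,
        Nat.cast_pred (Fintype.card_pos_iff.2 ⟨j⟩), hcard]
      ring
    rw [Finset.sum_const, nsmul_eq_mul, hc] at h1
    linarith
  refine ⟨k, ?_⟩
  -- the weight `t` of `y` is chosen so that the coefficient of `b k` becomes zero
  let t := s⁻¹ * (ε * m⁻¹)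
  let w : Option ι → ℝ := fun o => o.elim t
    fun j => s⁻¹ * (1 - (if j = k then ε + 1 else 0)) - t * b.coord j y
  let z : Option ι → E := fun o => o.elim y b
  have hmem : ∑ o, w o • z o ∈ K := by
    refine hK.sum_mem (fun o _ => ?_) ?_ fun o _ => ?_
    · cases o with
      | none => simp only [w, t, Option.elim_none]; positivity
      | some j =>
        simp only [w, t, Option.elim_some]
        rw [mul_assoc, ← mul_sub]
        refine mul_nonneg (inv_nonneg.2 hs.le) ?_
        split_ifs with h
        · subst h
          have : b.coord j y = -m := by linarith
          rw [this, mul_neg, inv_mul_cancel_right₀ hm0.ne']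
          linarith
        · have h1 : m⁻¹ ≤ δ⁻¹ := inv_anti₀ hδ hmδ.le
          have h2 : ε * m⁻¹ * b.coord j y ≤ ε * m⁻¹ * (1 + (s + ε) * m) :=
            mul_le_mul_of_nonneg_left (hupper j) (by positivity)
          have h3 : ε * m⁻¹ * (1 + (s + ε) * m) = ε * (m⁻¹ + (s + ε)) := by field_simp
          have h4 : ε * (m⁻¹ + (s + ε)) ≤ ε * (δ⁻¹ + (s + ε)) := by gcongr
          linarith
    · rw [Fintype.sum_option]
      simp only [w, Option.elim_none, Option.elim_some, Finset.sum_sub_distrib, ← Finset.mul_sum,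
        hsum, Finset.sum_ite_eq', Finset.mem_univ, if_true, Finset.sum_const, Finset.card_univ,
        nsmul_eq_mul, mul_one, hcard]
      field_simp
      ring
    · cases o with
      | none => exact hy
      | some j => exact hb j
  convert hmem using 1
  rw [Fintype.sum_option]
  simp only [w, z, Option.elim_none, Option.elim_some, sub_smul, mul_smul,
    Finset.sum_sub_distrib, ← Finset.smul_sum, one_smul, ite_smul, zero_smul, Finset.sum_ite_eq',
    Finset.mem_univ, if_true, b.linear_combination_coord_eq_self]
  abel

end

section

open Module

variable {E : Type*} [NormedAddCommGroup E] [NormedSpace ℝ E] [FiniteDimensional ℝ E]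

/-- Stability of the Minkowski asymmetry near its maximal value `n`: either `-K` lies in a translate
of `s K` (reflection in the point `c` with ratio `s⁻¹` maps `K` into itself), where `n = s + ε`, or
`K` is close to one of its inscribed simplices. -/
theorem exists_center_or_exists_simplex {K : Set E} (hKcpt : IsCompact K)
    (hK : Convex ℝ K) {s ε δ : ℝ} (hs : 0 < s) (hε0 : 0 ≤ ε) (hε1 : ε ≤ 1)
    (hrank : (finrank ℝ E : ℝ) = s + ε) (hδ : 0 < δ) (hεδ : ε * (δ⁻¹ + (s + ε)) ≤ 1) :
    (∃ c : E, ∀ x ∈ K, s⁻¹ • ((s + 1) • c - x) ∈ K) ∨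
      ∃ b : AffineBasis (Fin (finrank ℝ E + 1)) ℝ E, (∀ i, b i ∈ K) ∧
        ∀ y ∈ K, ∀ i, -δ ≤ b.coord i y := by
  classical
  by_cases hpts : ∀ p : Fin (finrank ℝ E + 1) → E, (∀ i, p i ∈ K) →
      ∃ c : E, ∀ i, s⁻¹ • ((s + 1) • c - p i) ∈ K
  · left
    let φ (x : E) : E ≃ₜ E := ((Homeomorph.smulOfNeZero (s + 1) (by positivity)).trans
      (Homeomorph.subRight x)).trans (Homeomorph.smulOfNeZero s⁻¹ (by positivity))
    have hφ (x c : E) : φ x c = s⁻¹ • ((s + 1) • c - x) := rfl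
    obtain ⟨c, hc⟩ := Convex.helly_theorem_compact' (𝕜 := ℝ) (F := fun x : K => φ x ⁻¹' K)
      (fun x u hu v hv α β hα hβ hαβ => by
        have := hK hu hv hα hβ hαβ
        rw [Set.mem_preimage, hφ]
        rw [hφ, hφ] at this
        convert this using 1
        have hx : (x : E) = α • (x : E) + β • (x : E) := by rw [← add_smul, hαβ, one_smul]
        conv_lhs => rw [hx]
        module)
      (fun x => (φ x).isCompact_preimage.2 hKcpt)
      fun I hI => by
        -- the at most `n + 1` given points are enumerated with repetitions
        rcases I.eq_empty_or_nonempty with rfl | hIne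
        · simp
        obtain ⟨q, hq⟩ : ∃ q : Fin (finrank ℝ E + 1) → I, Function.Surjective q := by
          obtain ⟨x, hx⟩ := hIne
          have : Nonempty I := ⟨⟨x, hx⟩⟩
          have e := I.equivFin
          have hle : I.card ≤ finrank ℝ E + 1 := hI
          exact ⟨_, (Function.invFun_surjective
            ((Fin.castLE_injective hle).comp e.injective))⟩
        obtain ⟨c, hc⟩ := hpts (fun i => (q i : K)) fun i => (q i : K).2
        refine ⟨c, Set.mem_iInter₂.2 fun x hx => ?_⟩
        obtain ⟨i, hi⟩ := hq ⟨x, hx⟩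
        have := hc i
        rw [hi] at this
        exact this
    exact ⟨c, fun x hx => Set.mem_iInter.1 hc ⟨x, hx⟩⟩
  · right
    push Not at hpts
    obtain ⟨p, hp, hno⟩ := hpts
    have hcard : (Fintype.card (Fin (finrank ℝ E + 1)) : ℝ) = s + ε + 1 := by
      rw [Fintype.card_fin, Nat.cast_add, hrank, Nat.cast_one]
    have hno' : ¬ ∃ k, s⁻¹ • (∑ i, p i - (ε + 1) • p k) ∈ K := fun ⟨k, hk⟩ => by
      obtain ⟨c, hc⟩ := exists_center_of_reflection_mem hK hs hε1 hcard hp k hk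
      obtain ⟨i, hi⟩ := hno c
      exact hi (hc i)
    have hind : AffineIndependent ℝ p := by
      by_contra hdep
      exact hno' (exists_reflection_mem_of_not_affineIndependent hK hs hε0 hε1 hcard hp hdep)
    refine ⟨⟨p, hind, hind.affineSpan_eq_top_iff_card_eq_finrank_add_one.2 (by simp)⟩, hp,
      fun y hy i => ?_⟩
    by_contra! hlt
    exact hno' (exists_reflection_mem_of_coord_lt hK hs hε0 hcard hδ hεδ _ hp hy hlt)

end

/-! ### Banach-Mazur ratios -/

section

open Module

/-- A sandwich `K ⊆ T L + a ⊆ r K + b` with `1 < r` gives a Banach-Mazur ratio: as `r ≠ 1`, a common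
translation absorbs `b`. -/
theorem mem_banachMazurRatios_of_sandwich {n : ℕ} {K L : Set (EuclideanSpace ℝ (Fin n))} {r : ℝ}
    (hr : 1 < r) (T : EuclideanSpace ℝ (Fin n) ≃ₗ[ℝ] EuclideanSpace ℝ (Fin n))
    (a b : EuclideanSpace ℝ (Fin n)) (h₁ : ∀ x ∈ K, ∃ y ∈ L, x = T y + a)
    (h₂ : ∀ y ∈ L, ∃ x ∈ K, T y + a = r • x + b) : r ∈ banachMazurRatios K L := by
  have hr1 : r - 1 ≠ 0 := (sub_pos.2 hr).ne'
  let u := (r - 1)⁻¹ • b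
  have hu : b + u = r • u := by
    have : (r - 1) • u = b := smul_inv_smul₀ hr1 b
    rw [sub_smul, one_smul] at this
    rw [← this]; abel
  refine ⟨by linarith, T, u, T.symm (a + u), ?_, ?_⟩
  · rintro _ ⟨x, hx, _, rfl, rfl⟩
    obtain ⟨y, hy, rfl⟩ := h₁ x hx
    exact ⟨y + T.symm (a + u), Set.add_mem_add hy rfl, by
      rw [map_add, T.apply_symm_apply]; exact (add_assoc _ _ _).symm⟩
  · rintro _ ⟨_, ⟨y, hy, _, rfl, rfl⟩, rfl⟩
    obtain ⟨x, hx, hxy⟩ := h₂ y hy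
    refine ⟨x + u, Set.add_mem_add hx rfl, ?_⟩
    simp only [map_add, LinearEquiv.apply_symm_apply, smul_add]
    rw [← hu, ← add_assoc, ← hxy]
    abel

/-- If `-K` lies in a translate of `s K`, then `n s` is a Banach-Mazur ratio. -/
theorem mem_banachMazurRatios_of_center_left {n : ℕ} (hn : n ≠ 0)
    {K L : Set (EuclideanSpace ℝ (Fin n))}
    (hK : IsCompact K) (hKconv : Convex ℝ K) (hKint : (interior K).Nonempty)
    (hL : IsCompact L) (hLconv : Convex ℝ L) (hLint : (interior L).Nonempty)
    {s : ℝ} (hs : 0 < s) (hns : 1 < n * s) {c : EuclideanSpace ℝ (Fin n)}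
    (hc : ∀ x ∈ K, s⁻¹ • ((s + 1) • c - x) ∈ K) : n * s ∈ banachMazurRatios K L := by
  have : NeZero n := ⟨hn⟩
  obtain ⟨T, a, w, hT, hw⟩ := exists_affine_image_subset_and_subset_neg_smul hK hKconv hKint
    hL hLconv hLint
  rw [finrank_euclideanSpace_fin] at hw
  refine mem_banachMazurRatios_of_sandwich hns T.symm (-T.symm a)
    (T.symm w - T.symm a - (n * (s + 1)) • c) (fun x hx => ⟨_, hT x hx, ?_⟩) fun y hy => ?_
  · simp
  · obtain ⟨x, hx, rfl⟩ := hw y hy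
    refine ⟨_, hc x hx, ?_⟩
    rw [mul_smul (n : ℝ) s, smul_inv_smul₀ hs.ne', map_sub, map_smul, T.symm_apply_apply]
    module

/-- If `-L` lies in a translate of `s L`, then `n s` is a Banach-Mazur ratio. -/
theorem mem_banachMazurRatios_of_center_right {n : ℕ} (hn : n ≠ 0)
    {K L : Set (EuclideanSpace ℝ (Fin n))}
    (hK : IsCompact K) (hKconv : Convex ℝ K) (hKint : (interior K).Nonempty)
    (hL : IsCompact L) (hLconv : Convex ℝ L) (hLint : (interior L).Nonempty)
    {s : ℝ} (hs : 0 < s) (hns : 1 < n * s) {c : EuclideanSpace ℝ (Fin n)}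
    (hc : ∀ y ∈ L, s⁻¹ • ((s + 1) • c - y) ∈ L) : n * s ∈ banachMazurRatios K L := by
  have : NeZero n := ⟨hn⟩
  obtain ⟨T, a, w, hT, hw⟩ := exists_affine_image_subset_and_subset_neg_smul hL hLconv hLint
    hK hKconv hKint
  rw [finrank_euclideanSpace_fin] at hw
  have hns0 : n * s ≠ 0 := by linarith
  refine mem_banachMazurRatios_of_sandwich hns
    (T.trans (LinearEquiv.smulOfNeZero ℝ _ (n * s) hns0)) (w - (n * (s + 1)) • T c)
    (w - (n * (s + 1)) • T c - (n * s) • a) (fun x hx => ?_) fun y hy => ⟨_, hT y hy, ?_⟩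
  · obtain ⟨y, hy, rfl⟩ := hw x hx
    refine ⟨_, hc y hy, ?_⟩
    rw [LinearEquiv.trans_apply, LinearEquiv.smulOfNeZero_apply, mul_smul (n : ℝ) s,
      map_smul, smul_inv_smul₀ hs.ne', map_sub, map_smul]
    module
  · rw [LinearEquiv.trans_apply, LinearEquiv.smulOfNeZero_apply]
    module

/-- A point whose barycentric coordinates are all at least `-δ` lies in the homothetic image of the
simplex with ratio `ρ = 1 + (n + 1) δ` and the same centroid. -/
theorem exists_weights_of_neg_le_coord {E ι : Type*} [AddCommGroup E] [Module ℝ E] [Fintype ι]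
    (b : AffineBasis ι ℝ E) {δ ρ : ℝ} (hρ : 0 < ρ) (hρδ : ρ = 1 + Fintype.card ι * δ) {y : E}
    (hy : ∀ i, -δ ≤ b.coord i y) :
    ∃ ν : ι → ℝ, (∀ i, 0 ≤ ν i) ∧ ∑ i, ν i = 1 ∧ y = ρ • ∑ i, ν i • b i - δ • ∑ i, b i := by
  refine ⟨fun i => ρ⁻¹ * (b.coord i y + δ), fun i => ?_, ?_, ?_⟩
  · have := hy i
    exact mul_nonneg (inv_nonneg.2 hρ.le) (by linarith)
  · rw [← Finset.mul_sum, Finset.sum_add_distrib, b.sum_coord_apply_eq_one, Finset.sum_const,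
      Finset.card_univ, nsmul_eq_mul, ← hρδ, inv_mul_cancel₀ hρ.ne']
  · simp only [mul_smul, ← Finset.smul_sum, smul_inv_smul₀ hρ.ne', add_smul,
      Finset.sum_add_distrib, b.linear_combination_coord_eq_self]
    abel

/-- Two affine bases with the same index type correspond under an affine isomorphism. -/
theorem AffineBasis.exists_linearEquiv_apply_add {E ι : Type*} [AddCommGroup E] [Module ℝ E]
    (b b' : AffineBasis ι ℝ E) : ∃ (T : E ≃ₗ[ℝ] E) (a : E), ∀ i, T (b i) + a = b' i := by
  obtain ⟨i₀⟩ := b.nonempty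
  refine ⟨(b.basisOf i₀).equiv (b'.basisOf i₀) (Equiv.refl _), b' i₀ -
    (b.basisOf i₀).equiv (b'.basisOf i₀) (Equiv.refl _) (b i₀), fun i => ?_⟩
  rcases eq_or_ne i i₀ with rfl | hi
  · abel
  have h := (b.basisOf i₀).equiv_apply ⟨i, hi⟩ (b'.basisOf i₀) (Equiv.refl _)
  rw [Equiv.refl_apply, AffineBasis.basisOf_apply, AffineBasis.basisOf_apply, vsub_eq_sub,
    vsub_eq_sub, map_sub] at h
  rw [add_sub_left_comm, h]
  abel

/-- If `K` and `L` each lie in the `ρ`-fold enlargement of an inscribed simplex, then `ρ ^ 2` is a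
Banach-Mazur ratio, because all simplices are affinely equivalent. -/
theorem sq_mem_banachMazurRatios_of_simplex {n : ℕ} {ι : Type*} [Fintype ι]
    {K L : Set (EuclideanSpace ℝ (Fin n))} (hK : Convex ℝ K) (hL : Convex ℝ L)
    {δ ρ : ℝ} (hρ : 1 < ρ) (hρδ : ρ = 1 + Fintype.card ι * δ)
    (b b' : AffineBasis ι ℝ (EuclideanSpace ℝ (Fin n)))
    (hb : ∀ i, b i ∈ K) (hbK : ∀ x ∈ K, ∀ i, -δ ≤ b.coord i x)
    (hb' : ∀ i, b' i ∈ L) (hbL : ∀ y ∈ L, ∀ i, -δ ≤ b'.coord i y) :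
    ρ ^ 2 ∈ banachMazurRatios K L := by
  have hρ0 : 0 < ρ := one_pos.trans hρ
  obtain ⟨T, a, hT⟩ := b'.exists_linearEquiv_apply_add b
  have hsum {ν : ι → ℝ} (hν : ∑ i, ν i = 1) : ∑ i, ν i • b i = T (∑ i, ν i • b' i) + a := by
    simp only [← hT, smul_add, Finset.sum_add_distrib, ← Finset.sum_smul, hν, one_smul, map_sum,
      map_smul]
  refine mem_banachMazurRatios_of_sandwich (by nlinarith)
    (T.trans (LinearEquiv.smulOfNeZero ℝ _ ρ hρ0.ne')) (ρ • a - δ • ∑ i, b i)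
    (-(ρ ^ 2) • a - (ρ * δ) • T (∑ i, b' i) + ρ • a - δ • ∑ i, b i) (fun x hx => ?_) fun y hy => ?_
  · obtain ⟨ν, hν0, hν1, hx⟩ := exists_weights_of_neg_le_coord b hρ0 hρδ (hbK x hx)
    refine ⟨_, hL.sum_mem (fun i _ => hν0 i) hν1 fun i _ => hb' i, ?_⟩
    rw [hx, hsum hν1, LinearEquiv.trans_apply, LinearEquiv.smulOfNeZero_apply]
    module
  · obtain ⟨ν, hν0, hν1, hy⟩ := exists_weights_of_neg_le_coord b' hρ0 hρδ (hbL y hy)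
    refine ⟨_, hK.sum_mem (fun i _ => hν0 i) hν1 fun i _ => hb i, ?_⟩
    rw [hy, hsum hν1, LinearEquiv.trans_apply, LinearEquiv.smulOfNeZero_apply, map_sub, map_smul,
      map_smul]
    module

end

/-! ### The bound on the distance -/

theorem mainTheorem2 (n : ℕ) (hn : 2 ≤ n) (K L : ConvexBody (EuclideanSpace ℝ (Fin n)))
    (hK : (interior (K : Set (EuclideanSpace ℝ (Fin n)))).Nonempty)
    (hL : (interior (L : Set (EuclideanSpace ℝ (Fin n)))).Nonempty) :
    banachMazurDist (K : Set (EuclideanSpace ℝ (Fin n))) (L : Set (EuclideanSpace ℝ (Fin n))) <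
      (n : ℝ) ^ 2 - (2 : ℝ) ^ (-22 : ℤ) * (n : ℝ) ^ (-7 : ℤ) := by
  have hn2 : (2 : ℝ) ≤ n := by exact_mod_cast hn
  have hn0 : (0 : ℝ) < n := by linarith
  have hsmall : (2 : ℝ) ^ (-22 : ℤ) * (n : ℝ) ^ (-7 : ℤ) < 1 / 4 := by
    have h1 : (n : ℝ) ^ (-7 : ℤ) ≤ 1 := zpow_le_one_of_nonpos₀ (by linarith) (by norm_num)
    have h2 : (2 : ℝ) ^ (-22 : ℤ) < 1 / 4 := by norm_num
    have h3 : (0 : ℝ) < (2 : ℝ) ^ (-22 : ℤ) := by positivity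
    nlinarith
  suffices h : ∃ r ∈ banachMazurRatios (K : Set (EuclideanSpace ℝ (Fin n))) L,
      r ≤ (n : ℝ) ^ 2 - 1 / 4 by
    obtain ⟨r, hr, hrn⟩ := h
    have : banachMazurDist (K : Set (EuclideanSpace ℝ (Fin n))) L ≤ r :=
      csInf_le (banachMazurRatios_bddBelow _ _) hr
    exact this.trans_lt (hrn.trans_lt (sub_lt_sub_left hsmall _))
  -- `ε` solves `ε (δ⁻¹ + n) = 1` for the `δ` with `1 + (n + 1) δ = 3 / 2`
  obtain ⟨ε, hε⟩ : ∃ ε : ℝ, ε = (3 * n + 2 : ℝ)⁻¹ := ⟨_, rfl⟩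
  obtain ⟨δ, hδ⟩ : ∃ δ : ℝ, δ = (2 * (n + 1) : ℝ)⁻¹ := ⟨_, rfl⟩
  have hε0 : 0 < ε := by rw [hε]; positivity
  have hδ0 : 0 < δ := by rw [hδ]; positivity
  have hεn : ε * (3 * n + 2) = 1 := by rw [hε]; exact inv_mul_cancel₀ (by positivity)
  have hε1 : ε ≤ 1 := by nlinarith
  have hs : 0 < n - ε := by linarith
  have hεδ : ε * (δ⁻¹ + (n - ε + ε)) ≤ 1 := by
    rw [hδ, inv_inv]
    linarith
  have hns : 1 < n * (n - ε) := by nlinarith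
  have hnsle : n * (n - ε) ≤ (n : ℝ) ^ 2 - 1 / 4 := by nlinarith
  have key (M : ConvexBody (EuclideanSpace ℝ (Fin n))) :=
    exists_center_or_exists_simplex M.isCompact M.convex hs hε0.le hε1
      (by rw [finrank_euclideanSpace_fin]; ring) hδ0 hεδ
  have hn' : n ≠ 0 := by omega
  rcases key K with ⟨c, hc⟩ | ⟨b, hb, hbK⟩
  · exact ⟨_, mem_banachMazurRatios_of_center_left hn' K.isCompact K.convex hK L.isCompact L.convex
      hL hs hns hc, hnsle⟩
  rcases key L with ⟨c, hc⟩ | ⟨b', hb', hbL⟩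
  · exact ⟨_, mem_banachMazurRatios_of_center_right hn' K.isCompact K.convex hK L.isCompact L.convex
      hL hs hns hc, hnsle⟩
  refine ⟨(3 / 2) ^ 2, sq_mem_banachMazurRatios_of_simplex K.convex L.convex (δ := δ) (by norm_num)
    ?_ b b' hb hbK hb' hbL, by nlinarith⟩
  rw [Fintype.card_fin, finrank_euclideanSpace_fin, hδ]
  push_cast
  field_simp
  norm_num
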